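/- Let $\alpha\in(1,2]$, let $\beta\ge 2$ be the conjugate exponent, $\frac1\alpha+\frac1\beta=1$, and let $\mu_\alpha$ be the probability measure on $\mathbb R$ given by $\mu_\alpha(dx)=Z_\alpha^{-1}e^{-|x|^\alpha}\,dx$, where $Z_\alpha=\int_{\mathbb R}e^{-|x|^\alpha}\,dx$. There exist constants $A,B>0$, depending only on $\alpha$, such that for every $C^\infty$ function $f:\mathbb R\to\mathbb R$ with $f\in L^2(\mu_\alpha)$ (not necessarily nonnegative or normalized), $$\mathrm{Ent}_{\mu_\alpha}(f^2)\le A\,\mathrm{Var}_{\mu_\alpha}(f)+B\int_{\Omega}\left|\frac{f'}{f}\right|^\beta f^2\,d\mu_\alpha .$$ Here $$\mathrm{Ent}_{\mu_\alpha}(f^2)=\int f^2\log\frac{f^2}{\int f^2d\mu_\alpha}\,d\mu_\alpha,\qquad \mathrm{Var}_{\mu_\alpha}(f)=\int f^2d\mu_\alpha-\Big(\int f\,d\mu_\alpha\Big)^2,$$ $$\Omega=\Big\{f_+\ge 2\Big(\int f_+^2d\mu_\alpha\Big)^{1/2}\Big\}\cup\Big\{f_-\ge 2\Big(\int f_-^2d\mu_\alpha\Big)^{1/2}\Big\},\qquad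 f_+=\max(f,0),\quad f_-=\max(-f,0).$$ The integrands $f^2\log\big(f^2/\int f^2d\mu_\alpha\big)$ and $|f'/f|^\beta f^2$ are taken to be $0$ at the points where $f=0$. The right-hand side may be $+\infty$, in which case nothing is asserted; when it is finite, the function $f^2\log\big(f^2/\int f^2d\mu_\alpha\big)$ is $\mu_\alpha$-integrable and the inequality holds. -/

import Mathlib

open MeasureTheory ProbabilityTheory
open scoped ContDiff

/-- The normalizing constant `∫ exp (-|x| ^ α) dx`. -/
noncomputable def partitionConst (α : ℝ) : ℝ := ∫ x : ℝ, Real.exp (-|x| ^ α)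

/-- The measure on the real line with Lebesgue density `exp (-|x| ^ α) / Z`, where `Z` is the
normalizing constant. -/
noncomputable def muAlpha (α : ℝ) : Measure ℝ :=
  (volume : Measure ℝ).withDensity
    (fun x => ENNReal.ofReal (Real.exp (-|x| ^ α) / partitionConst α))

/-- The integrand `g log (g / ∫ g dμ)` of the entropy (`0` where `g` vanishes). -/
noncomputable def entIntegrand (μ : Measure ℝ) (g : ℝ → ℝ) (x : ℝ) : ℝ :=
  g x * Real.log (g x / ∫ y, g y ∂μ)

/-- The entropy `∫ g log (g / ∫ g dμ) dμ` of a nonnegative function `g`. -/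
noncomputable def ent (μ : Measure ℝ) (g : ℝ → ℝ) : ℝ := ∫ x, entIntegrand μ g x ∂μ

/-- The positive part `max (f, 0)`. -/
def fPlus (f : ℝ → ℝ) (x : ℝ) : ℝ := max (f x) 0

/-- The negative part `max (-f, 0)`. -/
def fMinus (f : ℝ → ℝ) (x : ℝ) : ℝ := max (-f x) 0

/-- The set where the positive part of `f`, or the negative part of `f`, is at least twice its
own norm in `L²(μ)`. -/
def bigSet (μ : Measure ℝ) (f : ℝ → ℝ) : Set ℝ :=
  {x | 2 * Real.sqrt (∫ y, fPlus f y ^ 2 ∂μ) ≤ fPlus f x} ∪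
    {x | 2 * Real.sqrt (∫ y, fMinus f y ^ 2 ∂μ) ≤ fMinus f x}

/-- The function `|f' / f| ^ β f ^ 2` (`0` where `f` vanishes). -/
noncomputable def energyIntegrand (β : ℝ) (f : ℝ → ℝ) (x : ℝ) : ℝ :=
  |deriv f x / f x| ^ β * f x ^ 2

/-!
Write `dμ` for `muAlpha α`. Suppose `F ≥ 0` is `C¹` and `|F'| ≤ 2 F ^ (1 / α) D ^ (1 / β)` with
`F` and `D` integrable, and let `w = exp (-|x| ^ α) F`. Integrating `(x w)'` and absorbing the
term with `F'` by Young's inequality gives `∫ |x| ^ α F dμ ≤ C (∫ F dμ + ∫ D dμ)`. Bounding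
`sup w` by `∫ |w'|` then gives `F ≤ C (∫ F dμ + ∫ D dμ) exp (|x| ^ α)`. Together these bound
`∫ F log F dμ`, since `log F` is at most `|x| ^ α` up to a constant.

Normalize `∫ f₊² dμ = 1`. A `C¹` truncation `F` of `f₊²` that vanishes for `f₊ ≤ 2` satisfies the
hypothesis with `D = |f' / f| ^ β f²` on `{f₊ ≥ 2}`, and this controls the entropy where `f₊` is
large. Elsewhere `t² log t² - t² + 1 ≤ (t² - 1)² ≤ C (t - 1)²`, and
`∫ (f₊ - 1)² dμ ≤ 2 Var f₊`. The two signs recombine because entropy is subadditive on functions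
with disjoint supports and `Var f₊ + Var f₋ ≤ Var f`.
-/

open Filter Topology InformationTheory

lemma norm_le_integral_norm_deriv {E : Type*} [NormedAddCommGroup E] [NormedSpace ℝ E]
    [CompleteSpace E] {w : ℝ → E} (hw : Differentiable ℝ w) (hwi : Integrable w)
    (hw'i : Integrable (deriv w)) (x : ℝ) : ‖w x‖ ≤ ∫ y, ‖deriv w y‖ := by
  have hderiv : ∀ y ∈ Set.Ici x, HasDerivAt w (deriv w y) y := fun y _ => (hw y).hasDerivAt
  have hlim : Tendsto w atTop (𝓝 0) :=
    tendsto_zero_of_hasDerivAt_of_integrableOn_Ioi (fun y hy => hderiv y (Set.mem_Ici_of_Ioi hy))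
      hw'i.integrableOn hwi.integrableOn
  have hval : ∫ y in Set.Ioi x, deriv w y = -w x := by
    rw [integral_Ioi_of_hasDerivAt_of_tendsto' hderiv hw'i.integrableOn hlim, zero_sub]
  calc ‖w x‖ = ‖∫ y in Set.Ioi x, deriv w y‖ := by rw [hval, norm_neg]
    _ ≤ ∫ y in Set.Ioi x, ‖deriv w y‖ := norm_integral_le_integral_norm _
    _ ≤ ∫ y, ‖deriv w y‖ :=
      setIntegral_le_integral hw'i.norm (Eventually.of_forall fun _ => norm_nonneg _)

/- Integrating `(x w)' = w + x w'` over `[-R, R]` leaves the boundary term `R (w R + w (-R))`,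
which has the good sign. -/
lemma integrable_and_integral_le_of_mul_deriv_add_le {w m p : ℝ → ℝ} (hw : ContDiff ℝ 1 w)
    (hw0 : ∀ x, 0 ≤ w x) (hwi : Integrable w) (hm : Continuous m) (hm0 : ∀ x, 0 ≤ m x)
    (hp0 : ∀ x, 0 ≤ p x) (hpi : Integrable p) (h : ∀ x, x * deriv w x + m x ≤ p x) :
    Integrable m ∧ ∫ x, m x ≤ (∫ x, w x) + ∫ x, p x := by
  have hdc : Continuous fun x => w x + x * deriv w x :=
    hw.continuous.add (continuous_id.mul (hw.continuous_deriv le_rfl))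
  have hwp : Integrable fun x => w x + p x := hwi.add hpi
  have bound : ∀ R : ℝ, 0 ≤ R → ∫ x in -R..R, m x ≤ ∫ x, (w x + p x) := by
    intro R hR
    have hRR : -R ≤ R := by linarith
    have ftc : ∫ x in -R..R, (w x + x * deriv w x) = R * w R - -R * w (-R) :=
      intervalIntegral.integral_eq_sub_of_hasDerivAt (f := fun x => x * w x)
        (fun x _ => ((hasDerivAt_id x).mul
          (hw.differentiable one_ne_zero x).hasDerivAt).congr_deriv (by simp))
        (hdc.intervalIntegrable _ _)
    calc ∫ x in -R..R, m x
        ≤ ∫ x in -R..R, ((w x + p x) - (w x + x * deriv w x)) :=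
          intervalIntegral.integral_mono_on hRR (hm.intervalIntegrable _ _)
            (hwp.intervalIntegrable.sub (hdc.intervalIntegrable _ _))
            fun x _ => by linarith [h x]
      _ = (∫ x in -R..R, (w x + p x)) - (R * w R - -R * w (-R)) := by
          rw [intervalIntegral.integral_sub hwp.intervalIntegrable (hdc.intervalIntegrable _ _),
            ftc]
      _ ≤ ∫ x in -R..R, (w x + p x) := by
          linarith [mul_nonneg hR (hw0 R), mul_nonneg hR (hw0 (-R))]
      _ ≤ ∫ x, (w x + p x) := by
          rw [intervalIntegral.integral_of_le hRR]
          exact setIntegral_le_integral hwp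
            (Eventually.of_forall fun x => add_nonneg (hw0 x) (hp0 x))
  have hmi : Integrable m := by
    refine integrable_of_intervalIntegral_norm_bounded (l := atTop) (∫ x, (w x + p x))
      (fun R => hm.integrableOn_Ioc) tendsto_neg_atTop_atBot tendsto_id ?_
    filter_upwards [eventually_ge_atTop 0] with R hR
    simpa only [Real.norm_of_nonneg (hm0 _), id] using bound R hR
  refine ⟨hmi, ?_⟩
  rw [← integral_add hwi hpi]
  refine le_of_tendsto
    (intervalIntegral_tendsto_integral hmi tendsto_neg_atTop_atBot tendsto_id) ?_
  filter_upwards [eventually_ge_atTop 0] with R hR using bound R hR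

lemma exists_mul_two_mul_rpow_mul_rpow_le {α β δ : ℝ} (h : α.HolderConjugate β) (hδ : 0 < δ) :
    ∃ C : ℝ, 0 < C ∧ ∀ a s e : ℝ, 0 ≤ a → 0 ≤ s → 0 ≤ e →
      a * (2 * (s ^ (1 / α) * e ^ (1 / β))) ≤ δ * (a ^ α * s) + C * e := by
  have hα : 0 < α := h.pos
  have hβ : 0 < β := h.symm.pos
  set ε : ℝ := (α * δ / 2) ^ (1 / α)
  have hε : 0 < ε := by positivity
  have root_rpow : ∀ {p y : ℝ}, 0 < p → 0 ≤ y → (y ^ (1 / p)) ^ p = y := fun hp hy => by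
    rw [one_div, Real.rpow_inv_rpow hy hp.ne']
  refine ⟨2 * ε⁻¹ ^ β / β, by positivity, fun a s e ha hs he => ?_⟩
  have young := Real.young_inequality_of_nonneg (a := ε * (a * s ^ (1 / α)))
    (b := ε⁻¹ * e ^ (1 / β)) (by positivity) (by positivity) h
  rw [Real.mul_rpow hε.le (by positivity), Real.mul_rpow ha (by positivity),
    Real.mul_rpow (by positivity) (by positivity), root_rpow hα hs, root_rpow hβ he,
    root_rpow hα (by positivity)] at young
  calc a * (2 * (s ^ (1 / α) * e ^ (1 / β)))
      = 2 * (ε * (a * s ^ (1 / α)) * (ε⁻¹ * e ^ (1 / β))) := by field_simp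
    _ ≤ 2 * (α * δ / 2 * (a ^ α * s) / α + ε⁻¹ ^ β * e / β) := by gcongr
    _ = δ * (a ^ α * s) + 2 * ε⁻¹ ^ β / β * e := by field_simp

/-- The density of `muAlpha α` with respect to Lebesgue measure, up to normalization. -/
noncomputable def expWeight (α x : ℝ) : ℝ := Real.exp (-|x| ^ α)

lemma expWeight_pos (α x : ℝ) : 0 < expWeight α x := Real.exp_pos _

lemma partitionConst_pos {α : ℝ} (hα : 0 < α) : 0 < partitionConst α := by
  have h : partitionConst α = 2 * Real.Gamma (1 / α + 1) := by
    rw [← integral_exp_neg_rpow hα]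
    exact integral_comp_abs (f := fun x => Real.exp (-x ^ α))
  rw [h]
  exact mul_pos two_pos (Real.Gamma_pos_of_pos (by positivity))

lemma integrable_expWeight {α : ℝ} (hα : 0 < α) : Integrable (expWeight α) :=
  Integrable.of_integral_ne_zero (partitionConst_pos hα).ne'

lemma hasDerivAt_expWeight {α : ℝ} (hα : 1 < α) (x : ℝ) :
    HasDerivAt (expWeight α) (-(α * |x| ^ (α - 2) * x) * expWeight α x) x :=
  (hasDerivAt_abs_rpow x hα).neg.exp.congr_deriv (mul_comm _ _)

lemma contDiff_expWeight {α : ℝ} (hα : 1 < α) : ContDiff ℝ 1 (expWeight α) :=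
  (contDiff_norm_rpow (E := ℝ) hα).neg.exp

lemma continuous_expWeight {α : ℝ} (hα : 0 ≤ α) : Continuous (expWeight α) :=
  Real.continuous_exp.comp (continuous_abs.rpow_const fun _ => Or.inr hα).neg

lemma muAlpha_eq_smul {α : ℝ} (hα : 0 < α) :
    muAlpha α = ENNReal.ofReal (partitionConst α)⁻¹ •
      volume.withDensity fun x => ENNReal.ofReal (expWeight α x) := by
  rw [muAlpha, ← withDensity_smul _ (continuous_expWeight hα.le).measurable.ennreal_ofReal]
  congr 1 with x
  rw [Pi.smul_apply, smul_eq_mul,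
    ← ENNReal.ofReal_mul (inv_nonneg.2 (partitionConst_pos hα).le), div_eq_inv_mul, expWeight]

lemma integrable_muAlpha_iff {α : ℝ} (hα : 0 < α) {g : ℝ → ℝ} :
    Integrable g (muAlpha α) ↔ Integrable fun x => expWeight α x * g x := by
  rw [muAlpha_eq_smul hα, integrable_smul_measure
    (ENNReal.ofReal_pos.2 (inv_pos.2 (partitionConst_pos hα))).ne' ENNReal.ofReal_ne_top,
    integrable_withDensity_iff_integrable_smul'
      (continuous_expWeight hα.le).measurable.ennreal_ofReal (by simp)]
  simp only [ENNReal.toReal_ofReal (expWeight_pos α _).le, smul_eq_mul]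

lemma integral_expWeight_mul {α : ℝ} (hα : 0 < α) (g : ℝ → ℝ) :
    ∫ x, expWeight α x * g x = partitionConst α * ∫ x, g x ∂(muAlpha α) := by
  have hZ := partitionConst_pos hα
  rw [muAlpha_eq_smul hα, integral_smul_measure, integral_withDensity_eq_integral_toReal_smul
    (continuous_expWeight hα.le).measurable.ennreal_ofReal (by simp),
    ENNReal.toReal_ofReal (inv_pos.2 hZ).le, smul_eq_mul, mul_inv_cancel_left₀ hZ.ne']
  simp only [ENNReal.toReal_ofReal (expWeight_pos α _).le, smul_eq_mul]

lemma isProbabilityMeasure_muAlpha {α : ℝ} (hα : 0 < α) :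
    IsProbabilityMeasure (muAlpha α) where
  measure_univ := by
    have hZ := partitionConst_pos hα
    rw [muAlpha_eq_smul hα, Measure.smul_apply, withDensity_apply _ MeasurableSet.univ,
      Measure.restrict_univ, ← ofReal_integral_eq_lintegral_ofReal (integrable_expWeight hα)
        (Eventually.of_forall fun x => (expWeight_pos α x).le), smul_eq_mul,
      ← ENNReal.ofReal_mul (inv_nonneg.2 hZ.le)]
    exact (congrArg ENNReal.ofReal (inv_mul_cancel₀ hZ.ne')).trans ENNReal.ofReal_one

lemma abs_rpow_sub_two_mul_sq {α : ℝ} (hα : α ≠ 0) (x : ℝ) :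
    |x| ^ (α - 2) * x ^ 2 = |x| ^ α := by
  rcases eq_or_ne x 0 with rfl | hx
  · simp [Real.zero_rpow hα]
  · rw [← sq_abs, ← Real.rpow_two, ← Real.rpow_add (abs_pos.2 hx), sub_add_cancel]

lemma abs_abs_rpow_sub_two_mul_le {α : ℝ} (hα : 1 ≤ α) (x : ℝ) :
    |(|x| ^ (α - 2) * x)| ≤ 1 + |x| ^ α := by
  rcases eq_or_ne x 0 with rfl | hx
  · simp only [abs_zero, mul_zero]
    positivity
  have hx0 : 0 < |x| := abs_pos.2 hx
  have hpow : |(|x| ^ (α - 2) * x)| = |x| ^ (α - 1) := by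
    rw [abs_mul, abs_of_nonneg (by positivity : 0 ≤ |x| ^ (α - 2)), ← Real.rpow_add_one hx0.ne']
    ring_nf
  rw [hpow]
  rcases le_total |x| 1 with h | h
  · have := Real.rpow_le_one hx0.le h (sub_nonneg.2 hα)
    have : 0 ≤ |x| ^ α := by positivity
    linarith
  · have := Real.rpow_le_rpow_of_exponent_le h (by linarith : α - 1 ≤ α)
    linarith

section WeightedBounds

variable {α : ℝ} {F : ℝ → ℝ}

lemma deriv_expWeight_mul (hα : 1 < α) (hF : ContDiff ℝ 1 F) (x : ℝ) :
    deriv (fun x => expWeight α x * F x) x =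
      expWeight α x * (deriv F x - α * (|x| ^ (α - 2) * x) * F x) := by
  refine ((hasDerivAt_expWeight hα x).fun_mul
    (hF.differentiable one_ne_zero x).hasDerivAt).deriv.trans ?_
  ring

lemma integrable_and_integral_abs_rpow_mul_le {θ : ℝ} {P : ℝ → ℝ} (hα : 1 < α) (hθ : θ < α)
    (hF : ContDiff ℝ 1 F) (hF0 : ∀ x, 0 ≤ F x) (hFi : Integrable F (muAlpha α))
    (hP0 : ∀ x, 0 ≤ P x) (hPi : Integrable P (muAlpha α))
    (h : ∀ x, x * deriv F x ≤ θ * (|x| ^ α * F x) + P x) :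
    Integrable (fun x => |x| ^ α * F x) (muAlpha α) ∧
      (α - θ) * ∫ x, |x| ^ α * F x ∂(muAlpha α) ≤
        ∫ x, F x ∂(muAlpha α) + ∫ x, P x ∂(muAlpha α) := by
  have hα0 : 0 < α := by linarith
  have hθ' : 0 < α - θ := sub_pos.2 hθ
  have hpow : Continuous fun x : ℝ => |x| ^ α :=
    continuous_abs.rpow_const fun _ => Or.inr hα0.le
  have hvirial : ∀ x, x * deriv (fun x => expWeight α x * F x) x +
      expWeight α x * ((α - θ) * (|x| ^ α * F x)) ≤ expWeight α x * P x := fun x => by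
    rw [deriv_expWeight_mul hα hF]
    have := mul_le_mul_of_nonneg_left (h x) (expWeight_pos α x).le
    linear_combination this - α * expWeight α x * F x * abs_rpow_sub_two_mul_sq hα0.ne' x
  obtain ⟨hi, hle⟩ := integrable_and_integral_le_of_mul_deriv_add_le
    (w := fun x => expWeight α x * F x)
    (m := fun x => expWeight α x * ((α - θ) * (|x| ^ α * F x)))
    (p := fun x => expWeight α x * P x)
    ((contDiff_expWeight hα).mul hF) (fun x => mul_nonneg (expWeight_pos α x).le (hF0 x))
    ((integrable_muAlpha_iff hα0).1 hFi)
    ((continuous_expWeight hα0.le).mul (continuous_const.mul (hpow.mul hF.continuous)))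
    (fun x => mul_nonneg (expWeight_pos α x).le
      (mul_nonneg hθ'.le (mul_nonneg (by positivity) (hF0 x))))
    (fun x => mul_nonneg (expWeight_pos α x).le (hP0 x)) ((integrable_muAlpha_iff hα0).1 hPi)
    hvirial
  rw [integral_expWeight_mul hα0, integral_expWeight_mul hα0, integral_expWeight_mul hα0,
    ← mul_add, mul_le_mul_iff_right₀ (partitionConst_pos hα0), integral_const_mul] at hle
  exact ⟨(integrable_const_mul_iff hθ'.ne'.isUnit _).1 ((integrable_muAlpha_iff hα0).2 hi), hle⟩

lemma abs_le_mul_exp_abs_rpow (hα : 1 < α) (hF : ContDiff ℝ 1 F)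
    (hFi : Integrable F (muAlpha α)) (hF'i : Integrable (deriv F) (muAlpha α))
    (hMi : Integrable (fun x => |x| ^ α * F x) (muAlpha α)) (x : ℝ) :
    |F x| ≤ partitionConst α * (∫ x, |deriv F x| ∂(muAlpha α) +
      α * (∫ x, |F x| ∂(muAlpha α) + ∫ x, |x| ^ α * |F x| ∂(muAlpha α))) * Real.exp (|x| ^ α) := by
  have hα0 : 0 < α := by linarith
  set w : ℝ → ℝ := fun x => expWeight α x * F x
  set b : ℝ → ℝ := fun x => |deriv F x| + α * (|F x| + |x| ^ α * |F x|)
  have hw : ContDiff ℝ 1 w := (contDiff_expWeight hα).mul hF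
  have hMi' : Integrable (fun x => |x| ^ α * |F x|) (muAlpha α) := by
    refine hMi.abs.congr (Eventually.of_forall fun x => ?_)
    simp only [abs_mul, abs_of_nonneg (show 0 ≤ |x| ^ α by positivity)]
  have hmass : Integrable (fun x => α * (|F x| + |x| ^ α * |F x|)) (muAlpha α) :=
    (hFi.abs.add hMi').const_mul α
  have hb : Integrable (fun x => expWeight α x * b x) :=
    (integrable_muAlpha_iff hα0).1 (hF'i.abs.add hmass)
  have hw'le : ∀ x, ‖deriv w x‖ ≤ expWeight α x * b x := fun x => by
    rw [deriv_expWeight_mul hα hF, norm_mul, Real.norm_of_nonneg (expWeight_pos α x).le]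
    refine mul_le_mul_of_nonneg_left ?_ (expWeight_pos α x).le
    calc ‖deriv F x - α * (|x| ^ (α - 2) * x) * F x‖
        ≤ |deriv F x| + α * |(|x| ^ (α - 2) * x)| * |F x| := by
          refine (norm_sub_le _ _).trans_eq ?_
          rw [norm_mul, norm_mul, Real.norm_of_nonneg hα0.le]
          rfl
      _ ≤ |deriv F x| + α * (1 + |x| ^ α) * |F x| := by
          gcongr
          exact abs_abs_rpow_sub_two_mul_le hα.le x
      _ = b x := by ring
  have hw'i : Integrable (deriv w) :=
    hb.mono' (hw.continuous_deriv le_rfl).aestronglyMeasurable (Eventually.of_forall hw'le)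
  have hsup : expWeight α x * |F x| ≤ partitionConst α * ∫ x, b x ∂(muAlpha α) :=
    calc expWeight α x * |F x| = ‖w x‖ := by
          rw [norm_mul, Real.norm_of_nonneg (expWeight_pos α x).le, Real.norm_eq_abs]
      _ ≤ ∫ x, ‖deriv w x‖ := norm_le_integral_norm_deriv (hw.differentiable one_ne_zero)
          ((integrable_muAlpha_iff hα0).1 hFi) hw'i x
      _ ≤ ∫ x, expWeight α x * b x := integral_mono hw'i.norm hb hw'le
      _ = partitionConst α * ∫ x, b x ∂(muAlpha α) := integral_expWeight_mul hα0 b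
  rw [integral_add hF'i.abs hmass, integral_const_mul, integral_add hFi.abs hMi'] at hsup
  rwa [expWeight, Real.exp_neg, inv_mul_le_iff₀ (Real.exp_pos _), mul_comm] at hsup

end WeightedBounds

/-- The nonnegative `C¹` function `F` is integrable and its derivative is controlled by the
integrable density `D`. The exponents are those of the model case `F = f ^ 2`,
`D = |f' / f| ^ β * f ^ 2`, where `|F'| = 2 * (F ^ (1 / α) * D ^ (1 / β))`. -/
structure EnergyControlled (α β : ℝ) (F D : ℝ → ℝ) : Prop where
  contDiff : ContDiff ℝ 1 F
  nonneg : ∀ x, 0 ≤ F x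
  density_nonneg : ∀ x, 0 ≤ D x
  integrable : Integrable F (muAlpha α)
  integrable_density : Integrable D (muAlpha α)
  abs_deriv_le : ∀ x, |deriv F x| ≤ 2 * (F x ^ (1 / α) * D x ^ (1 / β))

section EnergyControlled

variable {α β : ℝ}

lemma exists_mul_abs_deriv_le (h : α.HolderConjugate β) :
    ∃ C : ℝ, 0 < C ∧ ∀ F D : ℝ → ℝ, EnergyControlled α β F D → ∀ x a : ℝ, 0 ≤ a →
      a * |deriv F x| ≤ (α - 1) * (a ^ α * F x) + C * D x := by
  obtain ⟨C, hC, young⟩ := exists_mul_two_mul_rpow_mul_rpow_le h (sub_pos.2 h.lt)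
  exact ⟨C, hC, fun F D hFD x a ha => (mul_le_mul_of_nonneg_left (hFD.abs_deriv_le x) ha).trans
    (young a (F x) (D x) ha (hFD.nonneg x) (hFD.density_nonneg x))⟩

lemma exists_integral_abs_rpow_mul_le (h : α.HolderConjugate β) :
    ∃ C : ℝ, 0 < C ∧ ∀ F D : ℝ → ℝ, EnergyControlled α β F D →
      Integrable (fun x => |x| ^ α * F x) (muAlpha α) ∧
        ∫ x, |x| ^ α * F x ∂(muAlpha α) ≤
          C * (∫ x, F x ∂(muAlpha α) + ∫ x, D x ∂(muAlpha α)) := by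
  obtain ⟨C, hC, hderiv⟩ := exists_mul_abs_deriv_le h
  refine ⟨1 + C, by positivity, fun F D hFD => ?_⟩
  obtain ⟨hMi, hM⟩ := integrable_and_integral_abs_rpow_mul_le h.lt (sub_one_lt α) hFD.contDiff
    hFD.nonneg hFD.integrable (fun x => mul_nonneg hC.le (hFD.density_nonneg x))
    (hFD.integrable_density.const_mul C) fun x =>
      (le_abs_self _).trans ((abs_mul _ _).trans_le (hderiv F D hFD x |x| (abs_nonneg x)))
  rw [sub_sub_cancel, one_mul, integral_const_mul] at hM
  have hF : 0 ≤ ∫ x, F x ∂(muAlpha α) := integral_nonneg hFD.nonneg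
  have hD : 0 ≤ ∫ x, D x ∂(muAlpha α) := integral_nonneg hFD.density_nonneg
  exact ⟨hMi, by linarith [mul_nonneg hC.le hF]⟩

lemma exists_integral_abs_deriv_le (h : α.HolderConjugate β) :
    ∃ C : ℝ, 0 < C ∧ ∀ F D : ℝ → ℝ, EnergyControlled α β F D →
      Integrable (deriv F) (muAlpha α) ∧
        ∫ x, |deriv F x| ∂(muAlpha α) ≤
          C * (∫ x, F x ∂(muAlpha α) + ∫ x, D x ∂(muAlpha α)) := by
  obtain ⟨C, hC, hderiv⟩ := exists_mul_abs_deriv_le h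
  have hα : 0 < α - 1 := sub_pos.2 h.lt
  refine ⟨α - 1 + C, by positivity, fun F D hFD => ?_⟩
  have hFi := hFD.integrable.const_mul (α - 1)
  have hDi := hFD.integrable_density.const_mul C
  have hle : ∀ x, |deriv F x| ≤ (α - 1) * F x + C * D x := fun x => by
    simpa only [one_mul, Real.one_rpow] using hderiv F D hFD x 1 zero_le_one
  have hF'i : Integrable (deriv F) (muAlpha α) := (hFi.add hDi).mono'
    (hFD.contDiff.continuous_deriv le_rfl).aestronglyMeasurable (Eventually.of_forall hle)
  have hF : 0 ≤ ∫ x, F x ∂(muAlpha α) := integral_nonneg hFD.nonneg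
  have hD : 0 ≤ ∫ x, D x ∂(muAlpha α) := integral_nonneg hFD.density_nonneg
  refine ⟨hF'i, (integral_mono hF'i.abs (hFi.add hDi) hle).trans ?_⟩
  simp only [Pi.add_apply]
  rw [integral_add hFi hDi, integral_const_mul, integral_const_mul]
  linarith [mul_nonneg hα.le hD, mul_nonneg hC.le hF]

lemma exists_le_mul_exp_abs_rpow (h : α.HolderConjugate β) :
    ∃ C : ℝ, 0 < C ∧ ∀ F D : ℝ → ℝ, EnergyControlled α β F D → ∀ x,
      F x ≤ C * (∫ x, F x ∂(muAlpha α) + ∫ x, D x ∂(muAlpha α)) * Real.exp (|x| ^ α) := by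
  obtain ⟨C₁, hC₁, hmoment⟩ := exists_integral_abs_rpow_mul_le h
  obtain ⟨C₂, hC₂, hderiv⟩ := exists_integral_abs_deriv_le h
  have hα : 0 < α := h.pos
  have hZ := partitionConst_pos hα
  refine ⟨partitionConst α * (C₂ + α * (1 + C₁)), by positivity, fun F D hFD x => ?_⟩
  obtain ⟨hMi, hM⟩ := hmoment F D hFD
  obtain ⟨hF'i, hF'⟩ := hderiv F D hFD
  have hD : 0 ≤ ∫ x, D x ∂(muAlpha α) := integral_nonneg hFD.density_nonneg
  have hsup := abs_le_mul_exp_abs_rpow h.lt hFD.contDiff hFD.integrable hF'i hMi x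
  simp only [abs_of_nonneg (hFD.nonneg _)] at hsup
  refine hsup.trans (mul_le_mul_of_nonneg_right ?_ (Real.exp_pos _).le)
  rw [mul_assoc (partitionConst α)]
  refine mul_le_mul_of_nonneg_left ?_ hZ.le
  linarith [mul_le_mul_of_nonneg_left hM hα.le, mul_nonneg hα.le hD]

end EnergyControlled

section PositivePart

variable {μ : Measure ℝ} {f : ℝ → ℝ}

lemma fMinus_eq_fPlus_neg (f : ℝ → ℝ) : fMinus f = fPlus fun x => -f x := rfl

lemma fPlus_nonneg (f : ℝ → ℝ) (x : ℝ) : 0 ≤ fPlus f x := le_max_right _ _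

lemma fPlus_sub_fMinus (f : ℝ → ℝ) (x : ℝ) : fPlus f x - fMinus f x = f x :=
  max_zero_sub_max_neg_zero_eq_self (f x)

lemma fPlus_mul_fMinus (f : ℝ → ℝ) (x : ℝ) : fPlus f x * fMinus f x = 0 := by
  rcases le_total 0 (f x) with hx | hx
  · rw [fMinus, max_eq_right (neg_nonpos.2 hx), mul_zero]
  · rw [fPlus, max_eq_right hx, zero_mul]

lemma fPlus_sq_add_fMinus_sq (f : ℝ → ℝ) (x : ℝ) : fPlus f x ^ 2 + fMinus f x ^ 2 = f x ^ 2 := by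
  rw [← fPlus_sub_fMinus f x]
  linear_combination 2 * fPlus_mul_fMinus f x

lemma fPlus_div_const (f : ℝ → ℝ) {c : ℝ} (hc : 0 ≤ c) (x : ℝ) :
    fPlus (fun y => f y / c) x = fPlus f x / c := by
  rw [fPlus, fPlus, ← max_div_div_right hc, zero_div]

lemma le_fPlus_iff {c : ℝ} (hc : 0 < c) (x : ℝ) : c ≤ fPlus f x ↔ c ≤ f x := by
  rw [fPlus, le_max_iff, or_iff_left hc.not_ge]

lemma memLp_fPlus {p : ENNReal} (hf : MemLp f p μ) : MemLp (fPlus f) p μ := hf.pos_part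

lemma memLp_fMinus {p : ENNReal} (hf : MemLp f p μ) : MemLp (fMinus f) p μ := hf.neg_part

lemma variance_fPlus_add_variance_fMinus_le [IsProbabilityMeasure μ] (hf : MemLp f 2 μ) :
    variance (fPlus f) μ + variance (fMinus f) μ ≤ variance f μ := by
  have hp := memLp_fPlus hf
  have hm := memLp_fMinus hf
  have hp0 : 0 ≤ ∫ x, fPlus f x ∂μ := integral_nonneg (fPlus_nonneg f)
  have hm0 : 0 ≤ ∫ x, fMinus f x ∂μ := integral_nonneg (fPlus_nonneg _)
  have hmean : ∫ x, f x ∂μ = ∫ x, fPlus f x ∂μ - ∫ x, fMinus f x ∂μ := by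
    rw [← integral_sub (hp.integrable one_le_two) (hm.integrable one_le_two)]
    simp only [fPlus_sub_fMinus]
  have hsq : ∫ x, f x ^ 2 ∂μ = ∫ x, fPlus f x ^ 2 ∂μ + ∫ x, fMinus f x ^ 2 ∂μ := by
    rw [← integral_add hp.integrable_sq hm.integrable_sq]
    simp only [fPlus_sq_add_fMinus_sq]
  rw [variance_eq_sub hp, variance_eq_sub hm, variance_eq_sub hf]
  simp only [Pi.pow_apply, hsq, hmean]
  linarith [mul_nonneg hp0 hm0]

end PositivePart

/-- A `C¹` truncation of `t ^ 2`, vanishing for `t ≤ 2` and comparable to `t ^ 2` for large `t`.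
The `β`-th power of a difference of `β`-th roots is chosen so that
`|(truncSq β ∘ f)'| = 2 * (truncSq β ∘ f) ^ (1 / α) * (|f' / f| ^ β * f ^ 2) ^ (1 / β)`
wherever `f ≥ 2`. -/
noncomputable def truncSq (β t : ℝ) : ℝ := (max t 2 ^ (2 / β) - 2 ^ (2 / β)) ^ β

section truncSq

variable {β t : ℝ}

lemma max_two_rpow_sub_nonneg (hβ : 0 ≤ β) (t : ℝ) : 0 ≤ max t 2 ^ (2 / β) - 2 ^ (2 / β) :=
  sub_nonneg.2 (Real.rpow_le_rpow two_pos.le (le_max_right t 2) (by positivity))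

lemma truncSq_nonneg (hβ : 0 ≤ β) (t : ℝ) : 0 ≤ truncSq β t :=
  Real.rpow_nonneg (max_two_rpow_sub_nonneg hβ t) β

lemma truncSq_of_le_two (hβ : β ≠ 0) (ht : t ≤ 2) : truncSq β t = 0 := by
  rw [truncSq, max_eq_right ht, sub_self, Real.zero_rpow hβ]

lemma truncSq_fPlus (β : ℝ) (f : ℝ → ℝ) (x : ℝ) : truncSq β (fPlus f x) = truncSq β (f x) := by
  rw [truncSq, truncSq, fPlus, max_assoc, max_eq_right two_pos.le]

lemma rpow_two_div_rpow (hβ : β ≠ 0) (ht : 0 ≤ t) : (t ^ (2 / β)) ^ β = t ^ 2 := by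
  rw [← Real.rpow_mul ht, div_mul_cancel₀ _ hβ, Real.rpow_two]

lemma truncSq_le_sq (hβ : 0 < β) (t : ℝ) : truncSq β t ≤ t ^ 2 := by
  rcases le_total t 2 with ht | ht
  · rw [truncSq_of_le_two hβ.ne' ht]
    exact sq_nonneg t
  · rw [← rpow_two_div_rpow hβ.ne' (two_pos.le.trans ht)]
    refine Real.rpow_le_rpow (max_two_rpow_sub_nonneg hβ.le t) ?_ hβ.le
    rw [max_eq_left ht]
    exact sub_le_self _ (by positivity)

lemma truncSq_le_four_mul_sub_one_sq (hβ : 0 < β) (t : ℝ) : truncSq β t ≤ 4 * (t - 1) ^ 2 := by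
  rcases le_total t 2 with ht | ht
  · rw [truncSq_of_le_two hβ.ne' ht]
    positivity
  · exact (truncSq_le_sq hβ t).trans (by nlinarith)

lemma sq_le_two_rpow_mul_truncSq (hβ : 0 < β) (ht : 2 ^ (1 + β / 2) ≤ t) :
    t ^ 2 ≤ 2 ^ β * truncSq β t := by
  have ht2 : 2 ≤ t := (Real.self_le_rpow_of_one_le one_le_two (by linarith)).trans ht
  have hroot : 2 * (2 : ℝ) ^ (2 / β) ≤ t ^ (2 / β) :=
    calc 2 * (2 : ℝ) ^ (2 / β) = (2 ^ (1 + β / 2)) ^ (2 / β) := by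
          rw [← Real.rpow_mul two_pos.le, ← Real.rpow_one_add' two_pos.le (by positivity)]
          congr 1
          field_simp
          ring
      _ ≤ t ^ (2 / β) := Real.rpow_le_rpow (by positivity) ht (by positivity)
  rw [truncSq, ← Real.mul_rpow two_pos.le (max_two_rpow_sub_nonneg hβ.le t), max_eq_left ht2,
    ← rpow_two_div_rpow hβ.ne' (two_pos.le.trans ht2)]
  exact Real.rpow_le_rpow (by positivity) (by linarith) hβ.le

lemma hasDerivAt_truncSq (hβ : 1 < β) (t : ℝ) :
    HasDerivAt (truncSq β) (2 * (max t 2 ^ (2 / β) - 2 ^ (2 / β)) ^ (β - 1) *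
      max t 2 ^ (2 / β - 1)) t := by
  set T' : ℝ → ℝ := fun t =>
    2 * (max t 2 ^ (2 / β) - 2 ^ (2 / β)) ^ (β - 1) * max t 2 ^ (2 / β - 1)
  have hβ0 : β ≠ 0 := by linarith
  have left : ∀ s ≤ 2, HasDerivWithinAt (truncSq β) (T' s) (Set.Iic 2) s := fun s hs => by
    have hT' : T' s = 0 := by
      simp only [T', max_eq_right hs, sub_self, Real.zero_rpow (sub_pos.2 hβ).ne', mul_zero,
        zero_mul]
    rw [hT']
    exact (hasDerivWithinAt_const s _ (0 : ℝ)).congr (fun y hy => truncSq_of_le_two hβ0 hy)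
      (truncSq_of_le_two hβ0 hs)
  have right : ∀ s, 2 ≤ s → HasDerivWithinAt (truncSq β) (T' s) (Set.Ici 2) s := fun s hs => by
    have h : HasDerivAt (fun y : ℝ => (y ^ (2 / β) - 2 ^ (2 / β)) ^ β) (T' s) s := by
      refine (((Real.hasDerivAt_rpow_const (Or.inl (two_pos.trans_le hs).ne')).sub_const
        _).rpow_const (Or.inr hβ.le)).congr_deriv ?_
      simp only [T', max_eq_left hs]
      field_simp
    exact h.hasDerivWithinAt.congr (fun y hy => by rw [truncSq, max_eq_left hy])
      (by rw [truncSq, max_eq_left hs])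
  rcases lt_trichotomy t 2 with ht | rfl | ht
  · exact (left t ht.le).hasDerivAt (Iic_mem_nhds ht)
  · simpa only [Set.Iic_union_Ici, hasDerivWithinAt_univ] using
      (left 2 le_rfl).union (right 2 le_rfl)
  · exact (right t ht.le).hasDerivAt (Ici_mem_nhds ht)

lemma contDiff_truncSq (hβ : 1 < β) : ContDiff ℝ 1 (truncSq β) := by
  have hmax : ∀ p : ℝ, Continuous fun t : ℝ => max t 2 ^ p := fun p =>
    (continuous_id.max continuous_const).rpow_const fun t =>
      Or.inl (lt_max_of_lt_right two_pos).ne'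
  refine contDiff_one_iff_deriv.2 ⟨fun t => (hasDerivAt_truncSq hβ t).differentiableAt, ?_⟩
  rw [funext fun t => (hasDerivAt_truncSq hβ t).deriv]
  exact (continuous_const.mul (((hmax _).sub continuous_const).rpow_const fun _ =>
    Or.inr (sub_pos.2 hβ).le)).mul (hmax _)

section Integral

variable {Ω : Type*} [MeasurableSpace Ω] {μ : Measure Ω} {g : Ω → ℝ}

lemma integrable_truncSq_comp (hβ : 1 < β) (hg : MemLp g 2 μ) :
    Integrable (fun x => truncSq β (g x)) μ :=
  hg.integrable_sq.mono'
    ((contDiff_truncSq hβ).continuous.comp_aestronglyMeasurable hg.aestronglyMeasurable)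
    (Eventually.of_forall fun x => by
      rw [Real.norm_of_nonneg (truncSq_nonneg (by linarith) (g x))]
      exact truncSq_le_sq (by linarith) (g x))

lemma integral_truncSq_comp_le_integral_sq (hβ : 1 < β) (hg : MemLp g 2 μ) :
    ∫ x, truncSq β (g x) ∂μ ≤ ∫ x, g x ^ 2 ∂μ :=
  integral_mono (integrable_truncSq_comp hβ hg) hg.integrable_sq
    fun x => truncSq_le_sq (by linarith) (g x)

lemma integral_truncSq_comp_le_four_mul [IsFiniteMeasure μ] (hβ : 1 < β) (hg : MemLp g 2 μ) :
    ∫ x, truncSq β (g x) ∂μ ≤ 4 * ∫ x, (g x - 1) ^ 2 ∂μ := by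
  rw [← integral_const_mul]
  exact integral_mono (integrable_truncSq_comp hβ hg)
    ((hg.sub (memLp_const 1)).integrable_sq.const_mul 4)
    fun x => truncSq_le_four_mul_sub_one_sq (by linarith) (g x)

end Integral

end truncSq

lemma energyIntegrand_nonneg (β : ℝ) (f : ℝ → ℝ) (x : ℝ) : 0 ≤ energyIntegrand β f x := by
  unfold energyIntegrand
  positivity

lemma energyIntegrand_neg (β : ℝ) (f : ℝ → ℝ) :
    energyIntegrand β (fun x => -f x) = energyIntegrand β f := by
  funext x
  simp only [energyIntegrand, deriv.fun_neg, neg_div_neg_eq, neg_sq]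

lemma energyIntegrand_div_const (β : ℝ) (f : ℝ → ℝ) {c : ℝ} (hc : c ≠ 0) :
    energyIntegrand β (fun x => f x / c) = fun x => energyIntegrand β f x / c ^ 2 := by
  funext x
  simp only [energyIntegrand, deriv_div_const, div_div_div_cancel_right₀ hc, div_pow,
    mul_div_assoc]

lemma energyIntegrand_rpow_one_div {β : ℝ} {f : ℝ → ℝ} {x : ℝ} (hβ : β ≠ 0) (hf : 0 < f x) :
    energyIntegrand β f x ^ (1 / β) = f x ^ (2 / β - 1) * |deriv f x| := by
  rw [energyIntegrand, Real.mul_rpow (by positivity) (sq_nonneg _), ← Real.rpow_mul (abs_nonneg _),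
    mul_one_div_cancel hβ, Real.rpow_one, ← Real.rpow_two, ← Real.rpow_mul hf.le, mul_one_div,
    Real.rpow_sub_one hf.ne', abs_div, abs_of_pos hf]
  ring

lemma abs_deriv_truncSq_fPlus_le {α β : ℝ} (h : α.HolderConjugate β) {f : ℝ → ℝ}
    (hf : Differentiable ℝ f) (x : ℝ) :
    |deriv (fun y => truncSq β (fPlus f y)) x| ≤ 2 * (truncSq β (fPlus f x) ^ (1 / α) *
      {y | 2 ≤ fPlus f y}.indicator (energyIntegrand β f) x ^ (1 / β)) := by
  have hβ : 1 < β := h.symm.lt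
  have hβ0 : 0 ≤ β := h.symm.nonneg
  simp only [truncSq_fPlus]
  have hderiv : deriv (fun y => truncSq β (f y)) x = _ :=
    ((hasDerivAt_truncSq hβ (f x)).comp x (hf x).hasDerivAt).deriv
  rw [hderiv]
  rcases lt_or_ge (f x) 2 with hx | hx
  · rw [max_eq_right hx.le, sub_self, Real.zero_rpow (sub_pos.2 hβ).ne', mul_zero, zero_mul,
      zero_mul, abs_zero]
    have := truncSq_nonneg hβ0 (f x)
    have := Set.indicator_nonneg (s := {y | 2 ≤ fPlus f y})
      (fun y _ => energyIntegrand_nonneg β f y) x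
    positivity
  · have hbase := max_two_rpow_sub_nonneg hβ0 (f x)
    have _ : 0 < max (f x) 2 := lt_max_of_lt_right two_pos
    have hmem : x ∈ {y | 2 ≤ fPlus f y} := (le_fPlus_iff two_pos x).2 hx
    have hroot : truncSq β (f x) ^ (1 / α) =
        (max (f x) 2 ^ (2 / β) - 2 ^ (2 / β)) ^ (β - 1) := by
      rw [truncSq, ← Real.rpow_mul hbase, mul_one_div, h.symm.div_conj_eq_sub_one]
    rw [Set.indicator_of_mem hmem, hroot,
      energyIntegrand_rpow_one_div h.symm.ne_zero (two_pos.trans_le hx), abs_mul,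
      abs_of_nonneg (by positivity), max_eq_left hx]
    exact le_of_eq (by ring)

lemma measurableSet_le_fPlus {f : ℝ → ℝ} (hf : Continuous f) (c : ℝ) :
    MeasurableSet {x | c ≤ fPlus f x} :=
  measurableSet_le measurable_const (hf.max continuous_const).measurable

lemma energyControlled_truncSq_fPlus {α β : ℝ} (h : α.HolderConjugate β) {f : ℝ → ℝ}
    (hf : ContDiff ℝ 1 f) (hfL : MemLp f 2 (muAlpha α))
    (hE : IntegrableOn (energyIntegrand β f) {x | 2 ≤ fPlus f x} (muAlpha α)) :
    EnergyControlled α β (fun x => truncSq β (fPlus f x))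
      ({x | 2 ≤ fPlus f x}.indicator (energyIntegrand β f)) where
  contDiff := by
    simp only [truncSq_fPlus]
    exact (contDiff_truncSq h.symm.lt).comp hf
  nonneg x := truncSq_nonneg h.symm.nonneg (fPlus f x)
  density_nonneg := Set.indicator_nonneg fun x _ => energyIntegrand_nonneg β f x
  integrable := integrable_truncSq_comp h.symm.lt (memLp_fPlus hfL)
  integrable_density := hE.integrable_indicator (measurableSet_le_fPlus hf.continuous 2)
  abs_deriv_le := abs_deriv_truncSq_fPlus_le h (hf.differentiable one_ne_zero)

lemma klFun_le_sub_one_sq {x : ℝ} (hx : 0 ≤ x) : klFun x ≤ (x - 1) ^ 2 := by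
  rcases hx.eq_or_lt with rfl | hx'
  · simp only [klFun_zero, zero_sub, even_two, Even.neg_pow, one_pow, le_refl]
  · have := mul_le_mul_of_nonneg_left (Real.log_le_sub_one_of_pos hx') hx
    rw [klFun_apply]
    linarith

/- Below the threshold `2 ^ (1 + β / 2)` the quadratic bound on `klFun` suffices; above it `t ^ 2`
is comparable to `truncSq β t`, whose logarithm is at most `H + s`. -/
lemma klFun_sq_le {β t H s : ℝ} (hβ : 0 < β) (ht : 0 ≤ t) (hH : 0 ≤ H) (hs : 0 ≤ s)
    (hT : truncSq β t ≤ H * Real.exp s) :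
    klFun (t ^ 2) ≤ (2 ^ (1 + β / 2) + 1) ^ 2 * (t - 1) ^ 2 +
      2 ^ β * ((β * Real.log 2 + H) * truncSq β t + s * truncSq β t) := by
  have hT0 := truncSq_nonneg hβ.le t
  have _ : 0 ≤ Real.log 2 := Real.log_nonneg one_le_two
  rcases le_total t (2 ^ (1 + β / 2)) with htK | htK
  · have hsmall : klFun (t ^ 2) ≤ (2 ^ (1 + β / 2) + 1) ^ 2 * (t - 1) ^ 2 :=
      calc klFun (t ^ 2) ≤ (t ^ 2 - 1) ^ 2 := klFun_le_sub_one_sq (sq_nonneg t)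
        _ = (t + 1) ^ 2 * (t - 1) ^ 2 := by ring
        _ ≤ (2 ^ (1 + β / 2) + 1) ^ 2 * (t - 1) ^ 2 := by gcongr
    exact hsmall.trans (le_add_of_nonneg_right (by positivity))
  · have ht1 : 1 ≤ t := (Real.one_le_rpow one_le_two (by positivity)).trans htK
    have hsq : t ^ 2 ≤ 2 ^ β * truncSq β t := sq_le_two_rpow_mul_truncSq hβ htK
    have hTpos : 0 < truncSq β t := by
      refine pos_of_mul_pos_right (lt_of_lt_of_le ?_ hsq) (by positivity : (0 : ℝ) ≤ 2 ^ β)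
      positivity
    have hHpos : 0 < H := pos_of_mul_pos_left (hTpos.trans_le hT) (Real.exp_pos s).le
    have hlog : Real.log (t ^ 2) ≤ β * Real.log 2 + H + s :=
      calc Real.log (t ^ 2) ≤ Real.log (2 ^ β * (H * Real.exp s)) :=
            Real.log_le_log (by positivity) (hsq.trans (by gcongr))
        _ = β * Real.log 2 + Real.log H + s := by
            rw [Real.log_mul (by positivity) (by positivity), Real.log_rpow two_pos,
              Real.log_mul hHpos.ne' (Real.exp_ne_zero s), Real.log_exp, add_assoc]
        _ ≤ β * Real.log 2 + H + s := by
            gcongr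
            exact Real.log_le_self hH
    have hlarge : klFun (t ^ 2) ≤
        2 ^ β * ((β * Real.log 2 + H) * truncSq β t + s * truncSq β t) :=
      calc klFun (t ^ 2) ≤ t ^ 2 * Real.log (t ^ 2) := by
            rw [klFun_apply]
            linarith [one_le_pow₀ (n := 2) ht1]
        _ ≤ 2 ^ β * truncSq β t * (β * Real.log 2 + H + s) :=
            mul_le_mul hsq hlog (Real.log_nonneg (one_le_pow₀ ht1)) (by positivity)
        _ = 2 ^ β * ((β * Real.log 2 + H) * truncSq β t + s * truncSq β t) := by ring
    exact hlarge.trans (le_add_of_nonneg_left (by positivity))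

lemma integrable_klFun_sq_and_integral_le {Ω : Type*} [MeasurableSpace Ω] {μ : Measure Ω}
    [IsFiniteMeasure μ] {β H : ℝ} {g s : Ω → ℝ} (hβ : 1 < β) (hg0 : ∀ x, 0 ≤ g x)
    (hg : MemLp g 2 μ) (hs0 : ∀ x, 0 ≤ s x) (hH : 0 ≤ H)
    (hsT : Integrable (fun x => s x * truncSq β (g x)) μ)
    (hT : ∀ x, truncSq β (g x) ≤ H * Real.exp (s x)) :
    Integrable (fun x => klFun (g x ^ 2)) μ ∧
      ∫ x, klFun (g x ^ 2) ∂μ ≤ (2 ^ (1 + β / 2) + 1) ^ 2 * ∫ x, (g x - 1) ^ 2 ∂μ +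
        2 ^ β * ((β * Real.log 2 + H) * ∫ x, truncSq β (g x) ∂μ +
          ∫ x, s x * truncSq β (g x) ∂μ) := by
  have hβ0 : 0 < β := by linarith
  have hTi := integrable_truncSq_comp hβ hg
  have hvar : Integrable (fun x => (2 ^ (1 + β / 2) + 1) ^ 2 * (g x - 1) ^ 2) μ :=
    (hg.sub (memLp_const 1)).integrable_sq.const_mul _
  have htail : Integrable (fun x => 2 ^ β *
      ((β * Real.log 2 + H) * truncSq β (g x) + s x * truncSq β (g x))) μ :=
    ((hTi.const_mul _).add hsT).const_mul _
  have hle : ∀ x, klFun (g x ^ 2) ≤ _ := fun x => klFun_sq_le hβ0 (hg0 x) hH (hs0 x) (hT x)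
  have hkl : Integrable (fun x => klFun (g x ^ 2)) μ := (hvar.add htail).mono'
    (continuous_klFun.comp_aestronglyMeasurable (hg.aestronglyMeasurable.pow 2))
    (Eventually.of_forall fun x => by
      rw [Real.norm_of_nonneg (klFun_nonneg (sq_nonneg _))]
      exact hle x)
  refine ⟨hkl, (integral_mono hkl (hvar.add htail) hle).trans_eq ?_⟩
  simp only [Pi.add_apply]
  rw [integral_add hvar htail, integral_const_mul, integral_const_mul,
    integral_add (hTi.const_mul _) hsT, integral_const_mul]

lemma integral_sub_one_sq_le {Ω : Type*} [MeasurableSpace Ω] {μ : Measure Ω}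
    [IsProbabilityMeasure μ] {g : Ω → ℝ} (hg0 : ∀ x, 0 ≤ g x) (hg : MemLp g 2 μ)
    (hg1 : ∫ x, g x ^ 2 ∂μ = 1) : ∫ x, (g x - 1) ^ 2 ∂μ ≤ 2 * variance g μ := by
  have hgi : Integrable g μ := hg.integrable one_le_two
  have hm0 : 0 ≤ ∫ x, g x ∂μ := integral_nonneg hg0
  have hexpand : ∫ x, (g x - 1) ^ 2 ∂μ = 2 - 2 * ∫ x, g x ∂μ := by
    have hpoint : ∀ x, (g x - 1) ^ 2 = g x ^ 2 - 2 * g x + 1 := fun x => by ring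
    have hdiff : Integrable (fun x => g x ^ 2 - 2 * g x) μ :=
      hg.integrable_sq.sub (hgi.const_mul 2)
    simp only [hpoint]
    rw [integral_add hdiff (integrable_const 1),
      integral_sub hg.integrable_sq (hgi.const_mul 2), integral_const_mul, hg1, integral_const,
      probReal_univ, one_smul]
    ring
  have hm1 : 0 ≤ 2 - 2 * ∫ x, g x ∂μ := hexpand ▸ integral_nonneg fun x => sq_nonneg _
  rw [hexpand, variance_eq_sub hg]
  simp only [Pi.pow_apply, hg1]
  nlinarith

section Ent

variable {μ : Measure ℝ} {g : ℝ → ℝ}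

lemma entIntegrand_eq_klFun (hg1 : ∫ x, g x ∂μ = 1) :
    entIntegrand μ g = fun x => klFun (g x) + (g x - 1) := by
  funext x
  rw [entIntegrand, hg1, div_one, klFun_apply]
  ring

lemma integrable_entIntegrand_of_klFun [IsFiniteMeasure μ] (hg : Integrable g μ)
    (hg1 : ∫ x, g x ∂μ = 1) (hkl : Integrable (fun x => klFun (g x)) μ) :
    Integrable (entIntegrand μ g) μ := by
  rw [entIntegrand_eq_klFun hg1]
  exact hkl.add (hg.sub (integrable_const 1))

lemma ent_eq_integral_klFun [IsProbabilityMeasure μ] (hg : Integrable g μ)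
    (hg1 : ∫ x, g x ∂μ = 1) (hkl : Integrable (fun x => klFun (g x)) μ) :
    ent μ g = ∫ x, klFun (g x) ∂μ := by
  have hdiff : Integrable (fun x => g x - 1) μ := hg.sub (integrable_const 1)
  simp only [ent, entIntegrand_eq_klFun hg1]
  rw [integral_add hkl hdiff, integral_sub hg (integrable_const 1), hg1, integral_const,
    probReal_univ, one_smul, sub_self, add_zero]

lemma entIntegrand_div_const (μ : Measure ℝ) (g : ℝ → ℝ) {c : ℝ} (hc : c ≠ 0) :
    entIntegrand μ (fun x => g x / c) = fun x => entIntegrand μ g x / c := by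
  funext x
  rw [entIntegrand, entIntegrand, integral_div, div_div_div_cancel_right₀ hc, div_mul_eq_mul_div]

lemma ent_div_const (μ : Measure ℝ) (g : ℝ → ℝ) {c : ℝ} (hc : c ≠ 0) :
    ent μ (fun x => g x / c) = ent μ g / c := by
  rw [ent, entIntegrand_div_const μ g hc, integral_div, ent]

lemma entIntegrand_eq_zero (hg0 : ∫ x, g x ∂μ = 0) : entIntegrand μ g = 0 := by
  funext x
  rw [entIntegrand, hg0, div_zero, Real.log_zero, mul_zero, Pi.zero_apply]

lemma integral_mul_log_div_le_ent {N : ℝ} (hg0 : ∀ x, 0 ≤ g x) (hg : Integrable g μ)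
    (hgN : ∫ x, g x ∂μ ≤ N) (hent : Integrable (entIntegrand μ g) μ) :
    Integrable (fun x => g x * Real.log (g x / N)) μ ∧
      ∫ x, g x * Real.log (g x / N) ∂μ ≤ ent μ g := by
  have hM0 : 0 ≤ ∫ x, g x ∂μ := integral_nonneg hg0
  rcases hM0.eq_or_lt with hM | hM
  · have hzero : g =ᵐ[μ] 0 := (integral_eq_zero_iff_of_nonneg hg0 hg).1 hM.symm
    have hlog : (fun x => g x * Real.log (g x / N)) =ᵐ[μ] 0 := by
      filter_upwards [hzero] with x hx
      rw [hx, Pi.zero_apply, zero_mul]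
    rw [ent, entIntegrand_eq_zero hM.symm]
    exact ⟨(integrable_congr hlog).2 (integrable_zero ..), (integral_congr_ae hlog).le⟩
  · have hN : 0 < N := hM.trans_le hgN
    have hsplit : (fun x => g x * Real.log (g x / N)) =
        fun x => entIntegrand μ g x + g x * Real.log ((∫ y, g y ∂μ) / N) := by
      funext x
      rcases (hg0 x).eq_or_lt with hx | hx
      · rw [entIntegrand, ← hx, zero_mul, zero_mul, zero_mul, add_zero]
      · rw [entIntegrand, Real.log_div hx.ne' hN.ne', Real.log_div hx.ne' hM.ne',
          Real.log_div hM.ne' hN.ne']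
        ring
    have hnonpos : (∫ x, g x ∂μ) * Real.log ((∫ x, g x ∂μ) / N) ≤ 0 :=
      mul_nonpos_of_nonneg_of_nonpos hM0
        (Real.log_nonpos (div_nonneg hM0 hN.le) (div_le_one_of_le₀ hgN hN.le))
    rw [hsplit]
    refine ⟨hent.add (hg.mul_const _), ?_⟩
    rw [integral_add hent (hg.mul_const _), integral_mul_const, ← ent]
    linarith

lemma ent_add_le {u v : ℝ → ℝ} (hu0 : ∀ x, 0 ≤ u x) (hv0 : ∀ x, 0 ≤ v x)
    (huv : ∀ x, u x * v x = 0) (hu : Integrable u μ) (hv : Integrable v μ)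
    (hue : Integrable (entIntegrand μ u) μ) (hve : Integrable (entIntegrand μ v) μ) :
    Integrable (entIntegrand μ fun x => u x + v x) μ ∧
      ent μ (fun x => u x + v x) ≤ ent μ u + ent μ v := by
  have hN : ∫ x, (u x + v x) ∂μ = ∫ x, u x ∂μ + ∫ x, v x ∂μ := integral_add hu hv
  obtain ⟨hui, hule⟩ := integral_mul_log_div_le_ent hu0 hu
    (hN.symm ▸ le_add_of_nonneg_right (integral_nonneg hv0)) hue
  obtain ⟨hvi, hvle⟩ := integral_mul_log_div_le_ent hv0 hv
    (hN.symm ▸ le_add_of_nonneg_left (integral_nonneg hu0)) hve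
  have hsplit : entIntegrand μ (fun x => u x + v x) = fun x =>
      u x * Real.log (u x / ∫ y, (u y + v y) ∂μ) + v x * Real.log (v x / ∫ y, (u y + v y) ∂μ) := by
    funext x
    rcases mul_eq_zero.1 (huv x) with hx | hx <;>
      simp only [entIntegrand, hx, zero_add, add_zero, zero_mul]
  rw [ent, hsplit, integral_add hui hvi]
  exact ⟨hui.add hvi, add_le_add hule hvle⟩

end Ent

section Main

variable {α β : ℝ}

lemma exists_integral_klFun_fPlus_sq_le (h : α.HolderConjugate β) :
    ∃ A B : ℝ, 0 < A ∧ 0 < B ∧ ∀ g : ℝ → ℝ, ContDiff ℝ 1 g → MemLp g 2 (muAlpha α) →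
      ∫ x, fPlus g x ^ 2 ∂(muAlpha α) = 1 →
      IntegrableOn (energyIntegrand β g) {x | 2 ≤ fPlus g x} (muAlpha α) →
      Integrable (fun x => klFun (fPlus g x ^ 2)) (muAlpha α) ∧
        ∫ x, klFun (fPlus g x ^ 2) ∂(muAlpha α) ≤
          A * ∫ x, (fPlus g x - 1) ^ 2 ∂(muAlpha α) +
            B * ∫ x in {x | 2 ≤ fPlus g x}, energyIntegrand β g x ∂(muAlpha α) := by
  obtain ⟨C₁, hC₁, moment⟩ := exists_integral_abs_rpow_mul_le h
  obtain ⟨C₂, hC₂, sup⟩ := exists_le_mul_exp_abs_rpow h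
  set K : ℝ := 2 ^ (1 + β / 2) + 1
  set L : ℝ := β * Real.log 2
  have hβ : 1 < β := h.symm.lt
  have : 0 ≤ L := mul_nonneg h.symm.nonneg (Real.log_nonneg one_le_two)
  have := isProbabilityMeasure_muAlpha h.pos
  refine ⟨K ^ 2 + 2 ^ β * (4 * (L + C₁ + C₂)), 2 ^ β * (C₁ + C₂), by positivity, by positivity,
    fun g hg hgL hg1 hE => ?_⟩
  have hgp := memLp_fPlus hgL
  have hFD := energyControlled_truncSq_fPlus h hg hgL hE
  obtain ⟨hMi, hM⟩ := moment _ _ hFD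
  have hF := sup _ _ hFD
  rw [integral_indicator (measurableSet_le_fPlus hg.continuous 2)] at hM hF
  have hS0 : 0 ≤ ∫ x, truncSq β (fPlus g x) ∂(muAlpha α) := integral_nonneg hFD.nonneg
  have hS1 := (integral_truncSq_comp_le_integral_sq hβ hgp).trans_eq hg1
  have hSQ := integral_truncSq_comp_le_four_mul hβ hgp
  have hE0 : 0 ≤ ∫ x in {x | 2 ≤ fPlus g x}, energyIntegrand β g x ∂(muAlpha α) :=
    integral_nonneg fun x => energyIntegrand_nonneg β g x
  obtain ⟨hkl, hle⟩ := integrable_klFun_sq_and_integral_le hβ (fPlus_nonneg g) hgp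
    (s := fun x => |x| ^ α) (fun x => by positivity) (mul_nonneg hC₂.le (add_nonneg hS0 hE0))
    hMi hF
  refine ⟨hkl, hle.trans ?_⟩
  set S := ∫ x, truncSq β (fPlus g x) ∂(muAlpha α)
  set M := ∫ x, |x| ^ α * truncSq β (fPlus g x) ∂(muAlpha α)
  set Q := ∫ x, (fPlus g x - 1) ^ 2 ∂(muAlpha α)
  set E := ∫ x in {x | 2 ≤ fPlus g x}, energyIntegrand β g x ∂(muAlpha α)
  have hHS : C₂ * (S + E) * S ≤ C₂ * (S + E) := mul_le_of_le_one_right (by positivity) hS1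
  calc K ^ 2 * Q + 2 ^ β * ((L + C₂ * (S + E)) * S + M)
      ≤ K ^ 2 * Q + 2 ^ β * (L * S + C₂ * (S + E) + C₁ * (S + E)) := by rw [add_mul]; gcongr
    _ = K ^ 2 * Q + 2 ^ β * ((L + C₁ + C₂) * S) + 2 ^ β * (C₁ + C₂) * E := by ring
    _ ≤ K ^ 2 * Q + 2 ^ β * ((L + C₁ + C₂) * (4 * Q)) + 2 ^ β * (C₁ + C₂) * E := by gcongr
    _ = (K ^ 2 + 2 ^ β * (4 * (L + C₁ + C₂))) * Q + 2 ^ β * (C₁ + C₂) * E := by ring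

lemma exists_ent_fPlus_sq_le_of_integral_eq_one (h : α.HolderConjugate β) :
    ∃ A B : ℝ, 0 < A ∧ 0 < B ∧ ∀ g : ℝ → ℝ, ContDiff ℝ 1 g → MemLp g 2 (muAlpha α) →
      ∫ x, fPlus g x ^ 2 ∂(muAlpha α) = 1 →
      IntegrableOn (energyIntegrand β g) {x | 2 ≤ fPlus g x} (muAlpha α) →
      Integrable (entIntegrand (muAlpha α) fun x => fPlus g x ^ 2) (muAlpha α) ∧
        ent (muAlpha α) (fun x => fPlus g x ^ 2) ≤ A * variance (fPlus g) (muAlpha α) +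
          B * ∫ x in {x | 2 ≤ fPlus g x}, energyIntegrand β g x ∂(muAlpha α) := by
  obtain ⟨A, B, hA, hB, klBound⟩ := exists_integral_klFun_fPlus_sq_le h
  have := isProbabilityMeasure_muAlpha h.pos
  refine ⟨A * 2, B, by positivity, hB, fun g hg hgL hg1 hE => ?_⟩
  obtain ⟨hkl, hle⟩ := klBound g hg hgL hg1 hE
  have hgp := memLp_fPlus hgL
  refine ⟨integrable_entIntegrand_of_klFun hgp.integrable_sq hg1 hkl, ?_⟩
  rw [ent_eq_integral_klFun hgp.integrable_sq hg1 hkl, mul_assoc]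
  refine hle.trans (by gcongr; exact integral_sub_one_sq_le (fPlus_nonneg g) hgp hg1)

lemma exists_ent_fPlus_sq_le (h : α.HolderConjugate β) :
    ∃ A B : ℝ, 0 < A ∧ 0 < B ∧ ∀ f : ℝ → ℝ, ContDiff ℝ 1 f → MemLp f 2 (muAlpha α) →
      IntegrableOn (energyIntegrand β f)
        {x | 2 * √(∫ y, fPlus f y ^ 2 ∂(muAlpha α)) ≤ fPlus f x} (muAlpha α) →
      Integrable (entIntegrand (muAlpha α) fun x => fPlus f x ^ 2) (muAlpha α) ∧
        ent (muAlpha α) (fun x => fPlus f x ^ 2) ≤ A * variance (fPlus f) (muAlpha α) +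
          B * ∫ x in {x | 2 * √(∫ y, fPlus f y ^ 2 ∂(muAlpha α)) ≤ fPlus f x},
            energyIntegrand β f x ∂(muAlpha α) := by
  obtain ⟨A, B, hA, hB, normalized⟩ := exists_ent_fPlus_sq_le_of_integral_eq_one h
  refine ⟨A, B, hA, hB, fun f hf hfL hE => ?_⟩
  set N := ∫ y, fPlus f y ^ 2 ∂(muAlpha α)
  have hN : 0 ≤ N := integral_nonneg fun x => sq_nonneg _
  rcases hN.eq_or_lt with hN0 | hNpos
  · rw [ent, entIntegrand_eq_zero hN0.symm]
    simp only [Pi.zero_apply, integral_zero]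
    have := variance_nonneg (fPlus f) (muAlpha α)
    have : 0 ≤ ∫ x in {x | 2 * √N ≤ fPlus f x}, energyIntegrand β f x ∂(muAlpha α) :=
      integral_nonneg fun x => energyIntegrand_nonneg β f x
    exact ⟨integrable_zero .., by positivity⟩
  have hc : 0 < √N := Real.sqrt_pos.2 hNpos
  have hone : ∫ x, fPlus f x ^ 2 / N ∂(muAlpha α) = 1 := by
    rw [integral_div]
    exact div_self hNpos.ne'
  have key := normalized (fun x => f x / √N) (hf.div_const _)
    (by simpa only [div_eq_mul_inv] using hfL.mul_const (√N)⁻¹)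
  simp only [fPlus_div_const f hc.le, div_pow, Real.sq_sqrt hN, le_div_iff₀ hc,
    energyIntegrand_div_const β f hc.ne', funext (fPlus_div_const f hc.le)] at key
  obtain ⟨hent, hle⟩ := key hone (hE.div_const N)
  rw [entIntegrand_div_const _ _ hNpos.ne'] at hent
  rw [ent_div_const _ _ hNpos.ne', integral_div] at hle
  simp only [div_eq_mul_inv _ (√N), variance_mul_const] at hle
  simp only [inv_pow, Real.sq_sqrt hN, ← div_eq_mul_inv, ← mul_div_assoc, ← add_div,
    div_le_div_iff_of_pos_right hNpos] at hle
  refine ⟨?_, hle⟩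
  simpa only [div_mul_cancel₀ _ hNpos.ne'] using hent.mul_const N

end Main

theorem mainTheorem6_general {α β : ℝ} (h : α.HolderConjugate β) :
    ∃ A B : ℝ, 0 < A ∧ 0 < B ∧
      ∀ f : ℝ → ℝ, ContDiff ℝ 1 f → MemLp f 2 (muAlpha α) →
        IntegrableOn (energyIntegrand β f) (bigSet (muAlpha α) f) (muAlpha α) →
          Integrable (entIntegrand (muAlpha α) (fun x => f x ^ 2)) (muAlpha α) ∧
          ent (muAlpha α) (fun x => f x ^ 2) ≤
            A * variance f (muAlpha α) +
              B * ∫ x in bigSet (muAlpha α) f, energyIntegrand β f x ∂(muAlpha α) := by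
  obtain ⟨A, B, hA, hB, posPart⟩ := exists_ent_fPlus_sq_le h
  have := isProbabilityMeasure_muAlpha h.pos
  refine ⟨A, 2 * B, hA, by positivity, fun f hf hfL hE => ?_⟩
  obtain ⟨hpi, hp⟩ := posPart f hf hfL (hE.mono_set Set.subset_union_left)
  obtain ⟨hmi, hm⟩ := posPart (fun x => -f x) hf.neg hfL.neg <| by
    rw [energyIntegrand_neg]
    exact hE.mono_set Set.subset_union_right
  simp only [energyIntegrand_neg, ← fMinus_eq_fPlus_neg] at hmi hm
  have energy_le : ∀ s ⊆ bigSet (muAlpha α) f, ∫ x in s, energyIntegrand β f x ∂(muAlpha α) ≤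
      ∫ x in bigSet (muAlpha α) f, energyIntegrand β f x ∂(muAlpha α) := fun s hs =>
    setIntegral_mono_set hE (Eventually.of_forall (energyIntegrand_nonneg β f)) hs.eventuallyLE
  obtain ⟨hi, hle⟩ := ent_add_le (fun x => sq_nonneg (fPlus f x)) (fun x => sq_nonneg (fMinus f x))
    (fun x => by rw [← mul_pow, fPlus_mul_fMinus, zero_pow two_ne_zero])
    (memLp_fPlus hfL).integrable_sq (memLp_fMinus hfL).integrable_sq hpi hmi
  simp only [fPlus_sq_add_fMinus_sq] at hi hle
  refine ⟨hi, hle.trans ((add_le_add hp hm).trans ?_)⟩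
  have hvar := mul_le_mul_of_nonneg_left (variance_fPlus_add_variance_fMinus_le hfL) hA.le
  have hEp := mul_le_mul_of_nonneg_left (energy_le _ Set.subset_union_left) hB.le
  have hEm := mul_le_mul_of_nonneg_left (energy_le _ Set.subset_union_right) hB.le
  linarith

/-- The integrand of the energy is nonnegative, so where it is not integrable the right-hand side
is infinite and there is nothing to assert. Where it is integrable, the entropy is asserted to be
finite and to satisfy the inequality. -/
theorem mainTheorem6 (α β : ℝ) (hα : 1 < α) (hα2 : α ≤ 2) (hβ : 1 / α + 1 / β = 1) :
    ∃ A B : ℝ, 0 < A ∧ 0 < B ∧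
      ∀ f : ℝ → ℝ, ContDiff ℝ ∞ f → MemLp f 2 (muAlpha α) →
        IntegrableOn (energyIntegrand β f) (bigSet (muAlpha α) f) (muAlpha α) →
          Integrable (entIntegrand (muAlpha α) (fun x => f x ^ 2)) (muAlpha α) ∧
          ent (muAlpha α) (fun x => f x ^ 2) ≤
            A * variance f (muAlpha α) +
              B * ∫ x in bigSet (muAlpha α) f, energyIntegrand β f x ∂(muAlpha α) := by
  obtain ⟨A, B, hA, hB, hmain⟩ :=
    mainTheorem6_general (Real.holderConjugate_iff.2 ⟨hα, by simpa only [one_div] using hβ⟩)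
  exact ⟨A, B, hA, hB, fun f hf => hmain f (hf.of_le (by exact_mod_cast le_top))⟩
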